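/- For a permutation $\sigma\in\mathfrak S_n$ of $[n]=\{1,\dots,n\}$, call $i\in[n]$ a cycle valley (cval) if $\sigma^{-1}(i)>i<\sigma(i)$, a cycle peak (cpeak) if $\sigma^{-1}(i)<i>\sigma(i)$, a cycle double fall (cdfall) if $\sigma^{-1}(i)>i>\sigma(i)$, a cycle double rise (cdrise) if $\sigma^{-1}(i)<i<\sigma(i)$, and a fixed point (fix) if $\sigma(i)=i$. Let $\mathrm{cyc}(\sigma)$ be the number of cycles of $\sigma$ (fixed points included), and put $$\begin{aligned} \mathrm{ucross}(j,\sigma)&=\#\{i<j<k<l:\ k=\sigma(i),\ l=\sigma(j)\}, & \mathrm{unest}(j,\sigma)&=\#\{i<j<k<l:\ k=\sigma(j),\ l=\sigma(i)\},\\ \mathrm{lcross}(k,\sigma)&=\#\{i<j<k<l:\ i=\sigma(k),\ j=\sigma(l)\}, & \mathrm{lnest}(k,\sigma)&=\#\{i<j<k<l:\ i=\sigma(l),\ j=\sigma(k)\},\\ \mathrm{lev}(j,\sigma)&=\#\{i<j<l:\ l=\sigma(i)\}, \end{aligned}$$ where in the first two lines the distinguished index ($j$, resp. $k$) is fixed and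 the other three indices vary over $[n]$, and in the last line $j$ is fixed and $i,l$ vary. Let $a=(a_\ell)_{\ell\ge0}$, $b=(b_{\ell,\ell'})_{\ell,\ell'\ge0}$, $c=(c_{\ell,\ell'})_{\ell,\ell'\ge0}$, $d=(d_{\ell,\ell'})_{\ell,\ell'\ge0}$, $e=(e_\ell)_{\ell\ge0}$ and $\lambda$ be indeterminates (equivalently, arbitrary elements of a commutative ring), and for $n\ge0$ define $$\begin{aligned}\widehat Q_n(a,b,c,d,e,\lambda)=\sum_{\sigma\in\mathfrak S_n}\lambda^{\mathrm{cyc}(\sigma)}&\prod_{i\in\mathrm{cval}}a_{\mathrm{ucross}(i,\sigma)+\mathrm{unest}(i,\sigma)}\prod_{i\in\mathrm{cpeak}}b_{\mathrm{lcross}(i,\sigma),\,\mathrm{lnest}(i,\sigma)}\prod_{i\in\mathrm{cdfall}}c_{\mathrm{lcross}(i,\sigma),\,\mathrm{lnest}(i,\sigma)}\\&\times\prod_{i\in\mathrm{cdrise}}d_{\mathrm{ucross}(i,\sigma)+\mathrm{unest}(i,\sigma),\,\mathrm{unest}(\sigma^{-1}(i),\sigma)}\prod_{i\in\mathrm{fix}}e_{\mathrm{lev}(i,\sigma)}.\end{aligned}$$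 Then, as formal power series in $t$, $$\sum_{n=0}^\infty\widehat Q_n(a,b,c,d,e,\lambda)\,t^n=\cfrac{1}{1-\gamma_0t-\cfrac{\beta_1t^2}{1-\gamma_1t-\cfrac{\beta_2t^2}{1-\cdots}}}$$ (the right-hand side being the coefficientwise limit of its finite truncations), with coefficients $$\gamma_n=c^\star_{n-1}+d^\natural_{n-1}+\lambda e_n\quad(n\ge0),\qquad \beta_n=(\lambda+n-1)\,a_{n-1}\,b^\star_{n-1}\quad(n\ge1),$$ where $$b^\star_{n-1}=\sum_{\ell=0}^{n-1}b_{\ell,n-1-\ell},\qquad c^\star_{n-1}=\sum_{\ell=0}^{n-1}c_{\ell,n-1-\ell},\qquad d^\natural_{n-1}=\sum_{\ell=0}^{n-1}d_{n-1,\ell}$$ (empty sums, equal to $0$, when $n=0$). -/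

import Mathlib

noncomputable section

namespace PermJ

/-! ### Jacobi-type continued fractions of formal power series -/

section JFraction

variable {R : Type*} [CommRing R]

/-- The finite continued fraction with `m` levels that starts at level `k`,
`1 / (1 - γ_k t - β_{k+1} t^2 / (1 - γ_{k+1} t - β_{k+2} t^2 / (⋯ / (1 - γ_{k+m-1} t))))`,
as a formal power series in `t`. Each denominator has constant coefficient `1`, so that
`PowerSeries.invOfUnit _ 1` is its genuine inverse. -/
def jConvergent (γ β : ℕ → R) : ℕ → ℕ → PowerSeries R
  | 0, _ => 0
  | m + 1, k =>
      PowerSeries.invOfUnit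
        (1 - PowerSeries.C (γ k) * PowerSeries.X
          - PowerSeries.C (β (k + 1)) * PowerSeries.X ^ 2 * jConvergent γ β m (k + 1)) 1

/-- The denominators in `jConvergent` are genuinely inverted. -/
theorem jConvergent_mul_denominator (γ β : ℕ → R) (m k : ℕ) :
    (1 - PowerSeries.C (γ k) * PowerSeries.X
      - PowerSeries.C (β (k + 1)) * PowerSeries.X ^ 2 * jConvergent γ β m (k + 1))
      * jConvergent γ β (m + 1) k = 1 := by
  rw [jConvergent]
  apply PowerSeries.mul_invOfUnit
  simp

/-- `f = 1 / (1 - γ_0 t - β_1 t^2 / (1 - γ_1 t - β_2 t^2 / (1 - ⋯)))` as formal power series: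
the convergents of the infinite continued fraction converge to `f` coefficientwise, i.e. in the
`t`-adic topology. The value `β 0` plays no role. -/
def HasJFraction (f : PowerSeries R) (γ β : ℕ → R) : Prop :=
  ∀ N : ℕ, ∀ᶠ m in Filter.atTop,
    PowerSeries.coeff N (jConvergent γ β m 0) = PowerSeries.coeff N f

end JFraction

/-! ### Permutation statistics

The index set `[n]` is `Fin n` with its usual order. -/

section Statistics

variable {n : ℕ}

/-- Number of cycles, every fixed point counting as a cycle. -/
def cyc (σ : Equiv.Perm (Fin n)) : ℕ :=
  Nat.card (Quotient (Equiv.Perm.SameCycle.setoid σ))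

/-- Cycle valleys: `σ⁻¹(i) > i < σ(i)`. -/
def cval (σ : Equiv.Perm (Fin n)) : Finset (Fin n) :=
  Finset.univ.filter fun i => i < σ⁻¹ i ∧ i < σ i

/-- Cycle peaks: `σ⁻¹(i) < i > σ(i)`. -/
def cpeak (σ : Equiv.Perm (Fin n)) : Finset (Fin n) :=
  Finset.univ.filter fun i => σ⁻¹ i < i ∧ σ i < i

/-- Cycle double falls: `σ⁻¹(i) > i > σ(i)`. -/
def cdfall (σ : Equiv.Perm (Fin n)) : Finset (Fin n) :=
  Finset.univ.filter fun i => i < σ⁻¹ i ∧ σ i < i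

/-- Cycle double rises: `σ⁻¹(i) < i < σ(i)`. -/
def cdrise (σ : Equiv.Perm (Fin n)) : Finset (Fin n) :=
  Finset.univ.filter fun i => σ⁻¹ i < i ∧ i < σ i

/-- Fixed points. -/
def fix (σ : Equiv.Perm (Fin n)) : Finset (Fin n) :=
  Finset.univ.filter fun i => σ i = i

/-- Upper crossings with `j` in second position: quadruplets `i < j < k < l` with
`k = σ(i)` and `l = σ(j)`; they are determined by `i`. -/
def ucross (σ : Equiv.Perm (Fin n)) (j : Fin n) : ℕ :=
  (Finset.univ.filter fun i => i < j ∧ j < σ i ∧ σ i < σ j).card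

/-- Upper nestings with `j` in second position: quadruplets `i < j < k < l` with
`k = σ(j)` and `l = σ(i)`; they are determined by `i`. -/
def unest (σ : Equiv.Perm (Fin n)) (j : Fin n) : ℕ :=
  (Finset.univ.filter fun i => i < j ∧ j < σ j ∧ σ j < σ i).card

/-- Lower crossings with `k` in third position: quadruplets `i < j < k < l` with
`i = σ(k)` and `j = σ(l)`; they are determined by `l`. -/
def lcross (σ : Equiv.Perm (Fin n)) (k : Fin n) : ℕ :=
  (Finset.univ.filter fun l => σ k < σ l ∧ σ l < k ∧ k < l).card

/-- Lower nestings with `k` in third position: quadruplets `i < j < k < l` with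
`i = σ(l)` and `j = σ(k)`; they are determined by `l`. -/
def lnest (σ : Equiv.Perm (Fin n)) (k : Fin n) : ℕ :=
  (Finset.univ.filter fun l => σ l < σ k ∧ σ k < k ∧ k < l).card

/-- The level of `j`: the number of `i < j < l` with `l = σ(i)`. -/
def lev (σ : Equiv.Perm (Fin n)) (j : Fin n) : ℕ :=
  (Finset.univ.filter fun i => i < j ∧ j < σ i).card

end Statistics

section Polynomials

variable {R : Type*} [CommRing R]

/-- The polynomial `Q̂_n(a, b, c, d, e, λ)`, evaluated at elements of a commutative ring. -/
def Qhat (a : ℕ → R) (b c d : ℕ → ℕ → R) (e : ℕ → R) (lam : R) (n : ℕ) : R :=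
  ∑ σ : Equiv.Perm (Fin n),
    lam ^ cyc σ
      * (∏ i ∈ cval σ, a (ucross σ i + unest σ i))
      * (∏ i ∈ cpeak σ, b (lcross σ i) (lnest σ i))
      * (∏ i ∈ cdfall σ, c (lcross σ i) (lnest σ i))
      * (∏ i ∈ cdrise σ, d (ucross σ i + unest σ i) (unest σ (σ⁻¹ i)))
      * (∏ i ∈ fix σ, e (lev σ i))

/-- `starPred x n` is `x*_{n-1} = ∑_{ℓ=0}^{n-1} x_{ℓ, n-1-ℓ}`, the empty sum `0` if `n = 0`. -/
def starPred (x : ℕ → ℕ → R) (n : ℕ) : R :=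
  ∑ l ∈ Finset.range n, x l (n - 1 - l)

/-- `naturalPred x n` is `x♮_{n-1} = ∑_{ℓ=0}^{n-1} x_{n-1, ℓ}`, the empty sum `0` if `n = 0`. -/
def naturalPred (x : ℕ → ℕ → R) (n : ℕ) : R :=
  ∑ l ∈ Finset.range n, x (n - 1) l

end Polynomials

end PermJ

end

/-!
A permutation is built by deciding, for `p = 0, 1, …` in turn, on the values `σ p` and `σ⁻¹ p` as
far as they do not exceed `p`. What has been decided before `p` is a partial permutation of
`{0, …, p - 1}`: closed cycles and, say, `k` open paths. Then `p` is a fixed point, starts a new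
path (valley), extends a path at its end (double rise) or at its start (double fall), or is put
between the end of one path and the start of another or the same one (peak). The statistics that
occur in `Qhat` are such that the weight of `p` depends on this choice alone:

* a fixed point has weight `e k`, and closes a cycle; a valley has weight `a k`;
* a double rise has weight `d (k - 1) l`, where `l` is the rank of the chosen end among all ends, so
  that the sum over the choices is `naturalPred d k`;
* a double fall has weight `c (k - 1 - l) l`, where `l` is the rank of the chosen start among all
  starts, so that the sum over the choices is `starPred c k`;
* a peak has weight `b (k - 1 - l) l` with `l` as before, while the end can be chosen freely among
  `k`; one of these `k` choices closes a cycle. So the sum is `(λ + k - 1) * starPred b k`.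

Hence the total weight of all completions depends on `k` only and is a generating polynomial of
weighted Motzkin paths (`PermJ.sum_extensions_eq_motzkin`). By Flajolet's theorem
(`PermJ.hasJFraction_motzkin`) these are enumerated by a Jacobi-type continued fraction.

Partial permutations are encoded without partial functions: every open path is closed up to a
cycle, and the set `S` of the ends of the open paths is kept alongside
(`PermJ.IsPartialPerm`). Each choice then multiplies the permutation by at most two transpositions
of elements of distinct cycles, and each of these lowers the number of cycles by one
(`PermJ.cyc_mul_swap`).
-/

namespace PermJ

/-! ### Joining two cycles by a transposition -/

section Cycles

open Equiv Equiv.Perm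

variable {α : Type*} [DecidableEq α]

/-- Multiplying by a transposition glues at most the cycles of the two transposed elements; this
also holds when they lie in one cycle, which is then split. -/
theorem sameCycle_or_of_sameCycle_mul_swap (ρ : Perm α) (x y : α) {u v : α}
    (h : SameCycle (ρ * swap x y) u v) :
    SameCycle ρ u v ∨ (SameCycle ρ u x ∧ SameCycle ρ v y) ∨
      (SameCycle ρ u y ∧ SameCycle ρ v x) := by
  -- The relation "equivalent after gluing the classes of `x` and `y`" is preserved by one step.
  have step : ∀ w, SameCycle ρ w ((ρ * swap x y) w) ∨
      (SameCycle ρ w x ∧ SameCycle ρ ((ρ * swap x y) w) y) ∨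
      (SameCycle ρ w y ∧ SameCycle ρ ((ρ * swap x y) w) x) := by
    intro w
    rw [Perm.mul_apply]
    by_cases hx : w = x
    · subst hx
      exact Or.inr (Or.inl ⟨SameCycle.rfl, by simp [sameCycle_apply_left, SameCycle.rfl]⟩)
    · by_cases hy : w = y
      · subst hy
        exact Or.inr (Or.inr ⟨SameCycle.rfl, by simp [sameCycle_apply_left, SameCycle.rfl]⟩)
      · rw [swap_apply_of_ne_of_ne hx hy]
        exact Or.inl (by simp [sameCycle_apply_right, SameCycle.rfl])
  obtain ⟨i, rfl⟩ := h
  induction i using Int.induction_on with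
  | zero => exact Or.inl SameCycle.rfl
  | succ i ih =>
    have hs := step (((ρ * swap x y) ^ (i : ℤ)) u)
    rw [← Perm.mul_apply, ← zpow_one_add, add_comm] at hs
    rcases ih with h1 | ⟨h1, h2⟩ | ⟨h1, h2⟩ <;> rcases hs with h3 | ⟨h3, h4⟩ | ⟨h3, h4⟩
    · exact Or.inl (h1.trans h3)
    · exact Or.inr (Or.inl ⟨h1.trans h3, h4⟩)
    · exact Or.inr (Or.inr ⟨h1.trans h3, h4⟩)
    · exact Or.inr (Or.inl ⟨h1, h3.symm.trans h2⟩)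
    · exact Or.inr (Or.inl ⟨h1, h4⟩)
    · exact Or.inl (h1.trans h4.symm)
    · exact Or.inr (Or.inr ⟨h1, h3.symm.trans h2⟩)
    · exact Or.inl (h1.trans h4.symm)
    · exact Or.inr (Or.inr ⟨h1, h4⟩)
  | pred i ih =>
    have hs := step (((ρ * swap x y) ^ (-(i : ℤ) - 1)) u)
    rw [← Perm.mul_apply, ← zpow_one_add, show 1 + (-(i : ℤ) - 1) = -i by ring] at hs
    rcases ih with h1 | ⟨h1, h2⟩ | ⟨h1, h2⟩ <;> rcases hs with h3 | ⟨h3, h4⟩ | ⟨h3, h4⟩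
    · exact Or.inl (h1.trans h3.symm)
    · exact Or.inr (Or.inr ⟨h1.trans h4, h3⟩)
    · exact Or.inr (Or.inl ⟨h1.trans h4, h3⟩)
    · exact Or.inr (Or.inl ⟨h1, h3.trans h2⟩)
    · exact Or.inl (h1.trans h3.symm)
    · exact Or.inr (Or.inl ⟨h1, h3⟩)
    · exact Or.inr (Or.inr ⟨h1, h3.trans h2⟩)
    · exact Or.inr (Or.inr ⟨h1, h3⟩)
    · exact Or.inl (h1.trans h3.symm)

theorem sameCycle_mul_swap_self [Finite α] (ρ : Perm α) {x y : α} (hxy : ¬ SameCycle ρ x y) :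
    SameCycle (ρ * swap x y) x y := by
  by_contra hr
  -- The new cycle of `y` runs through `ρ x, ρ (ρ x), …` until it meets `x`.
  have key : ∀ i : ℕ, SameCycle (ρ * swap x y) y ((ρ ^ (i + 1)) x) := by
    intro i
    induction i with
    | zero =>
      have : (ρ ^ (0 + 1)) x = (ρ * swap x y) y := by simp
      rw [this, sameCycle_apply_right]
    | succ i ih =>
      have hy : (ρ ^ (i + 1)) x ≠ y := fun h => hxy (h ▸ sameCycle_pow_right.2 SameCycle.rfl)
      have hx : (ρ ^ (i + 1)) x ≠ x := fun h => hr (by rw [h] at ih; exact ih.symm)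
      have : (ρ ^ (i + 1 + 1)) x = (ρ * swap x y) ((ρ ^ (i + 1)) x) := by
        rw [pow_succ', Perm.mul_apply, Perm.mul_apply, swap_apply_of_ne_of_ne hx hy]
      rw [this, sameCycle_apply_right]
      exact ih
  obtain ⟨i, hi, -, h⟩ := (SameCycle.refl ρ x).exists_pow_eq''
  obtain ⟨k, rfl⟩ := Nat.exists_eq_succ_of_ne_zero hi.ne'
  have := key k
  rw [show (ρ ^ (k + 1)) x = x from h] at this
  exact hr this.symm

/-- Multiplying by the transposition of two elements of distinct cycles glues these two cycles
and leaves the other ones alone. -/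
theorem sameCycle_mul_swap_iff [Finite α] (ρ : Perm α) {x y : α} (hxy : ¬ SameCycle ρ x y)
    {u v : α} :
    SameCycle (ρ * swap x y) u v ↔ SameCycle ρ u v ∨ (SameCycle ρ u x ∧ SameCycle ρ v y) ∨
      (SameCycle ρ u y ∧ SameCycle ρ v x) := by
  refine ⟨sameCycle_or_of_sameCycle_mul_swap ρ x y, ?_⟩
  have hr := sameCycle_mul_swap_self ρ hxy
  have mono : ∀ {p q : α}, SameCycle ρ p q → SameCycle (ρ * swap x y) p q := by
    intro p q h
    have h' : SameCycle (ρ * swap x y * swap x y) p q := by rwa [mul_swap_mul_self]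
    rcases sameCycle_or_of_sameCycle_mul_swap _ x y h' with h1 | ⟨h1, h2⟩ | ⟨h1, h2⟩
    · exact h1
    · exact h1.trans (hr.trans h2.symm)
    · exact h1.trans (hr.symm.trans h2.symm)
  rintro (h | ⟨h1, h2⟩ | ⟨h1, h2⟩)
  · exact mono h
  · exact (mono h1).trans (hr.trans (mono h2).symm)
  · exact (mono h1).trans (hr.symm.trans (mono h2).symm)

theorem cyc_mul_swap {n : ℕ} (ρ : Perm (Fin n)) {x y : Fin n} (hxy : ¬ SameCycle ρ x y) :
    cyc (ρ * swap x y) + 1 = cyc ρ := by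
  classical
  unfold cyc
  -- The old cycles other than that of `y` correspond to the new cycles.
  let f : {q : Quotient (SameCycle.setoid ρ) // q ≠ Quotient.mk _ y} →
      Quotient (SameCycle.setoid (ρ * swap x y)) :=
    fun q => Quotient.map' (s₁ := SameCycle.setoid ρ) (s₂ := SameCycle.setoid (ρ * swap x y)) id
      (fun _ _ h => (sameCycle_mul_swap_iff ρ hxy).2 (Or.inl h)) q.1
  have hf : Function.Bijective f := by
    constructor
    · rintro ⟨q, hq⟩ ⟨q', hq'⟩ h
      induction q using Quotient.inductionOn with | _ u => ?_
      induction q' using Quotient.inductionOn with | _ v => ?_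
      have hu : ¬ SameCycle ρ u y := fun h => hq (Quotient.sound h)
      have hv : ¬ SameCycle ρ v y := fun h => hq' (Quotient.sound h)
      have h' : SameCycle (ρ * swap x y) u v := Quotient.exact h
      rw [sameCycle_mul_swap_iff ρ hxy] at h'
      have h'' : SameCycle ρ u v := by tauto
      exact Subtype.ext (Quotient.sound h'')
    · intro q
      induction q using Quotient.inductionOn with | _ u => ?_
      by_cases hu : SameCycle ρ u y
      · refine ⟨⟨Quotient.mk _ x, fun h => hxy (Quotient.exact h)⟩, Quotient.sound ?_⟩
        exact (sameCycle_mul_swap_iff ρ hxy).2 (Or.inr (Or.inl ⟨SameCycle.rfl, hu⟩))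
      · exact ⟨⟨Quotient.mk _ u, fun h => hu (Quotient.exact h)⟩, rfl⟩
  rw [← Nat.card_congr (Equiv.ofBijective f hf)]
  have := Fintype.card_subtype_compl (fun q : Quotient (SameCycle.setoid ρ) => q = Quotient.mk _ y)
  rw [Fintype.card_subtype_eq] at this
  have hpos : 0 < Fintype.card (Quotient (SameCycle.setoid ρ)) :=
    Fintype.card_pos_iff.2 ⟨Quotient.mk _ y⟩
  simp only [Nat.card_eq_fintype_card, ne_eq]
  omega

theorem cyc_one (n : ℕ) : cyc (1 : Perm (Fin n)) = n := by
  unfold cyc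
  have : Function.Bijective (Quotient.mk (SameCycle.setoid (1 : Perm (Fin n)))) :=
    ⟨fun u v h => sameCycle_one.1 (Quotient.exact h), Quotient.mk_surjective⟩
  rw [← Nat.card_congr (Equiv.ofBijective _ this), Nat.card_fin]

end Cycles

/-! ### Weighted Motzkin paths and the continued fraction -/

section Motzkin

variable {R : Type*} [CommRing R]

/-- The generating polynomial of the Motzkin paths of length `m` that start at height `k` and end
at height `0`: a rise from height `k` has weight `α k`, a level step at height `k` has weight
`γ k`, and a fall from height `k` has weight `δ k`. -/
def motzkin (α γ δ : ℕ → R) : ℕ → ℕ → R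
  | 0, k => if k = 0 then 1 else 0
  | m + 1, 0 => γ 0 * motzkin α γ δ m 0 + α 0 * motzkin α γ δ m 1
  | m + 1, k + 1 => γ (k + 1) * motzkin α γ δ m (k + 1) + α (k + 1) * motzkin α γ δ m (k + 2)
      + δ (k + 1) * motzkin α γ δ m k

open PowerSeries in
theorem mk_motzkin_zero (α γ δ : ℕ → R) :
    (mk fun m => motzkin α γ δ m 0) = 1 + C (γ 0) * X * (mk fun m => motzkin α γ δ m 0)
      + C (α 0) * X * (mk fun m => motzkin α γ δ m 1) := by
  ext N
  rcases N with _ | N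
  · simp [motzkin]
  · simp [motzkin, mul_assoc, coeff_succ_X_mul, coeff_one]

open PowerSeries in
theorem mk_motzkin_succ (α γ δ : ℕ → R) (k : ℕ) :
    (mk fun m => motzkin α γ δ m (k + 1)) =
      C (γ (k + 1)) * X * (mk fun m => motzkin α γ δ m (k + 1))
      + C (α (k + 1)) * X * (mk fun m => motzkin α γ δ m (k + 2))
      + C (δ (k + 1)) * X * (mk fun m => motzkin α γ δ m k) := by
  ext N
  rcases N with _ | N
  · simp [motzkin]
  · simp [motzkin, mul_assoc, coeff_succ_X_mul]

open PowerSeries in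
/-- One step of Flajolet's argument: if a path that rises is continued by the `m`-level continued
fraction of the next height, then a whole path is given by the `(m + 1)`-level one. -/
theorem X_pow_dvd_sub_jConvergent_mul (γ β : ℕ → R) (m k : ℕ) (a d : R) (hβ : β (k + 1) = a * d)
    (f g r : PowerSeries R) (hf : f = C (γ k) * X * f + C a * X * g + r)
    (hg : X ^ m ∣ g - jConvergent γ β m (k + 1) * (C d * X * f)) :
    X ^ (m + 1) ∣ f - jConvergent γ β (m + 1) k * r := by
  obtain ⟨q, hq⟩ := hg
  have hJ := jConvergent_mul_denominator γ β m k
  rw [hβ, map_mul] at hJ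
  refine ⟨jConvergent γ β (m + 1) k * C a * q, ?_⟩
  linear_combination (-f) * hJ + jConvergent γ β (m + 1) k * hf
    + jConvergent γ β (m + 1) k * C a * X * hq

open PowerSeries in
theorem X_pow_dvd_motzkin_succ_sub (α γ δ β : ℕ → R) (hβ : ∀ k, β (k + 1) = α k * δ (k + 1))
    (m k : ℕ) :
    X ^ m ∣ (mk fun i => motzkin α γ δ i (k + 1))
      - jConvergent γ β m (k + 1) * (C (δ (k + 1)) * X * mk fun i => motzkin α γ δ i k) := by
  induction m generalizing k with
  | zero => simp
  | succ m ih =>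
    exact X_pow_dvd_sub_jConvergent_mul γ β m (k + 1) _ _ (hβ (k + 1)) _ _ _
      (mk_motzkin_succ α γ δ k) (ih (k + 1))

open PowerSeries in
/-- Flajolet's theorem: Motzkin paths from height `0` to height `0` are enumerated by a
Jacobi-type continued fraction. -/
theorem hasJFraction_motzkin (α γ δ β : ℕ → R) (hβ : ∀ k, β (k + 1) = α k * δ (k + 1)) :
    HasJFraction (mk fun m => motzkin α γ δ m 0) γ β := by
  intro N
  filter_upwards [Filter.eventually_gt_atTop N] with m hm
  obtain ⟨m, rfl⟩ : ∃ l, m = l + 1 := ⟨m - 1, by omega⟩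
  have h := X_pow_dvd_sub_jConvergent_mul γ β m 0 _ _ (hβ 0) _ _ 1
    ((mk_motzkin_zero α γ δ).trans (by ring)) (X_pow_dvd_motzkin_succ_sub α γ δ β hβ m 0)
  rw [mul_one] at h
  have := X_pow_dvd_iff.1 h N hm
  rw [map_sub, sub_eq_zero] at this
  exact this.symm

end Motzkin

/-! ### Ranks in a finite set -/

section Ranks

variable {α M : Type*} [LinearOrder α]

theorem sum_card_filter_lt [AddCommMonoid M] (T : Finset α) (g : ℕ → M) :
    ∑ y ∈ T, g (T.filter (· < y)).card = ∑ l ∈ Finset.range T.card, g l := by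
  induction T using Finset.induction_on_max with
  | empty => simp
  | insert x T hx ih =>
    have hxT : x ∉ T := fun h => lt_irrefl _ (hx x h)
    have h1 : (insert x T).filter (· < x) = T := by
      ext t
      simp only [Finset.mem_filter, Finset.mem_insert]
      exact ⟨fun h => h.1.resolve_left h.2.ne, fun h => ⟨Or.inr h, hx t h⟩⟩
    have h2 : ∀ y ∈ T, (insert x T).filter (· < y) = T.filter (· < y) := fun y hy => by
      rw [Finset.filter_insert, if_neg (hx y hy).le.not_gt]
    rw [Finset.sum_insert hxT, h1, Finset.sum_congr rfl fun y hy => by rw [h2 y hy], ih,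
      Finset.card_insert_of_notMem hxT, Finset.sum_range_succ, add_comm]

theorem card_filter_gt_eq (T : Finset α) {y : α} (hy : y ∈ T) :
    (T.filter (y < ·)).card = T.card - 1 - (T.filter (· < y)).card := by
  have h1 : T.filter (fun t => ¬ t < y) = insert y (T.filter (y < ·)) := by
    ext t
    simp only [Finset.mem_filter, Finset.mem_insert, not_lt, le_iff_eq_or_lt]
    constructor
    · rintro ⟨h, rfl | h'⟩
      · exact Or.inl rfl
      · exact Or.inr ⟨h, h'⟩
    · rintro (rfl | ⟨h, h'⟩)
      · exact ⟨hy, Or.inl rfl⟩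
      · exact ⟨h, Or.inr h'⟩
  have h2 := T.card_filter_add_card_filter_not (· < y)
  rw [h1, Finset.card_insert_of_notMem (by simp)] at h2
  omega

theorem sum_card_filter_gt_lt {R : Type*} [CommRing R] (T : Finset α) (x : ℕ → ℕ → R) :
    ∑ y ∈ T, x (T.filter (y < ·)).card (T.filter (· < y)).card = starPred x T.card := by
  rw [Finset.sum_congr rfl fun y hy => by rw [card_filter_gt_eq T hy],
    sum_card_filter_lt T fun r => x (T.card - 1 - r) r, starPred, ← Finset.sum_range_reflect]
  refine Finset.sum_congr rfl fun l hl => ?_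
  rw [Finset.mem_range] at hl
  congr 1
  omega

end Ranks

/-! ### The weight of a permutation as a product over the index set -/

section Weight

variable {R : Type*} [CommRing R]

/-- The contribution of the index `i` to the weight of `σ` in `Qhat`, the number of cycles being
left aside. -/
def localWeight (a : ℕ → R) (b c d : ℕ → ℕ → R) (e : ℕ → R) {n : ℕ} (σ : Equiv.Perm (Fin n))
    (i : Fin n) : R :=
  if σ i = i then e (lev σ i)
  else if i < σ⁻¹ i then
    if i < σ i then a (ucross σ i + unest σ i) else c (lcross σ i) (lnest σ i)
  else
    if i < σ i then d (ucross σ i + unest σ i) (unest σ (σ⁻¹ i)) else b (lcross σ i) (lnest σ i)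

theorem Qhat_eq_sum_prod_localWeight (a : ℕ → R) (b c d : ℕ → ℕ → R) (e : ℕ → R) (lam : R)
    (n : ℕ) :
    Qhat a b c d e lam n =
      ∑ σ : Equiv.Perm (Fin n), lam ^ cyc σ * ∏ i, localWeight a b c d e σ i := by
  unfold Qhat
  refine Finset.sum_congr rfl fun σ _ => ?_
  simp only [mul_assoc]
  congr 1
  simp only [cval, cpeak, cdfall, cdrise, fix, Finset.prod_filter, ← Finset.prod_mul_distrib]
  refine Finset.prod_congr rfl fun i _ => ?_
  have hfix : σ i = i ↔ σ⁻¹ i = i := by rw [Equiv.Perm.inv_eq_iff_eq, eq_comm]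
  unfold localWeight
  generalize σ⁻¹ i = q at hfix ⊢
  rcases lt_trichotomy (σ i) i with h | h | h <;> rcases lt_trichotomy q i with h' | h' | h'
  all_goals first
    | exact absurd (hfix.1 h) (ne_of_lt h')
    | exact absurd (hfix.1 h) (ne_of_gt h')
    | exact absurd (hfix.2 h') (ne_of_lt h)
    | exact absurd (hfix.2 h') (ne_of_gt h)
    | simp [h, h', h.ne, h.ne', h.not_gt, h'.not_gt]
    | simp [h, h']

end Weight

/-! ### Partial permutations and their extensions -/

section Extensions

open Equiv Equiv.Perm

variable {n : ℕ}

theorem apply_inv_apply (σ : Perm (Fin n)) (x : Fin n) : σ (σ⁻¹ x) = x := σ.apply_symm_apply x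

theorem inv_apply_apply (σ : Perm (Fin n)) (x : Fin n) : σ⁻¹ (σ x) = x := σ.symm_apply_apply x

/-- A partial permutation of `{0, …, j - 1}`, that is, a set of cycles and open paths, encoded by
the permutation `ρ` in which every open path is closed up to a cycle and every element from `j` on
is a fixed point, together with the set `S` of the last elements of the open paths. The first
element of the path that ends at `x ∈ S` is `ρ x`; by `sep`, no two paths are closed up
together. -/
structure IsPartialPerm (j : ℕ) (ρ : Perm (Fin n)) (S : Finset (Fin n)) : Prop where
  fixed : ∀ x : Fin n, j ≤ x.val → ρ x = x
  lt : ∀ x ∈ S, x.val < j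
  sep : ∀ x ∈ S, ∀ y ∈ S, SameCycle ρ x y → x = y

/-- The permutations whose restriction to `{0, …, j - 1}` is the partial permutation encoded by
`ρ` and `S`. -/
def extensions (j : ℕ) (ρ : Perm (Fin n)) (S : Finset (Fin n)) : Finset (Perm (Fin n)) :=
  Finset.univ.filter fun σ => ∀ x : Fin n, x.val < j → if x ∈ S then j ≤ (σ x).val else σ x = ρ x

theorem mem_extensions {p : Fin n} {ρ σ : Perm (Fin n)} {S : Finset (Fin n)} :
    σ ∈ extensions p.val ρ S ↔ ∀ x, x < p → if x ∈ S then p ≤ σ x else σ x = ρ x := by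
  simp only [extensions, Finset.mem_filter, Finset.mem_univ, true_and, ← Fin.lt_def, ← Fin.le_def]

theorem mem_extensions_succ {p : Fin n} {ρ σ : Perm (Fin n)} {S : Finset (Fin n)} :
    σ ∈ extensions (p.val + 1) ρ S ↔
      (∀ x, x < p → if x ∈ S then p < σ x else σ x = ρ x) ∧
        if p ∈ S then p < σ p else σ p = ρ p := by
  simp only [extensions, Finset.mem_filter, Finset.mem_univ, true_and, Nat.lt_succ_iff,
    Nat.succ_le_iff, ← Fin.lt_def, ← Fin.le_def]
  constructor
  · exact fun h => ⟨fun x hx => h x hx.le, h p le_rfl⟩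
  · rintro ⟨h1, h2⟩ x hx
    rcases hx.lt_or_eq with hx | rfl
    · exact h1 x hx
    · exact h2

namespace IsPartialPerm

variable {p : Fin n} {ρ σ : Perm (Fin n)} {S : Finset (Fin n)}

theorem apply_lt (h : IsPartialPerm p.val ρ S) {x : Fin n} (hx : x < p) : ρ x < p := by
  by_contra hc
  have h1 := h.fixed (ρ x) (not_lt.1 hc)
  exact hc (by rwa [ρ.injective h1])

theorem apply_self (h : IsPartialPerm p.val ρ S) : ρ p = p := h.fixed p le_rfl

theorem ne (h : IsPartialPerm p.val ρ S) {x : Fin n} (hx : x ∈ S) : x ≠ p :=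
  Fin.ne_of_lt (h.lt x hx)

theorem notMem (h : IsPartialPerm p.val ρ S) : p ∉ S := fun hp => h.ne hp rfl

theorem not_sameCycle (h : IsPartialPerm p.val ρ S) {x : Fin n} (hx : x ≠ p) :
    ¬ SameCycle ρ x p := fun hc => hx (hc.eq_of_right h.apply_self)

/-! The partial permutations of `{0, …, p}` that restrict to a given one of `{0, …, p - 1}`. -/

theorem fixedPoint (h : IsPartialPerm p.val ρ S) : IsPartialPerm (p.val + 1) ρ S :=
  ⟨fun x hx => h.fixed x (by omega), fun x hx => (h.lt x hx).trans (Nat.lt_succ_self _), h.sep⟩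

theorem valley (h : IsPartialPerm p.val ρ S) : IsPartialPerm (p.val + 1) ρ (insert p S) := by
  refine ⟨fun x hx => h.fixed x (by omega), fun x hx => ?_, fun x hx y hy hxy => ?_⟩
  · rcases Finset.mem_insert.1 hx with rfl | hx
    · exact Nat.lt_succ_self _
    · exact (h.lt x hx).trans (Nat.lt_succ_self _)
  · by_cases hxp : x = p
    · subst hxp
      exact hxy.eq_of_left h.apply_self
    · by_cases hyp : y = p
      · subst hyp
        exact hxy.eq_of_right h.apply_self
      · exact h.sep x (Finset.mem_of_mem_insert_of_ne hx hxp) y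
          (Finset.mem_of_mem_insert_of_ne hy hyp) hxy

theorem sep_mul_swap {T : Finset (Fin n)} {x z : Fin n}
    (hT : ∀ u ∈ T, ∀ v ∈ T, SameCycle ρ u v → u = v) (hxz : ¬ SameCycle ρ x z)
    (hx : (∀ v ∈ T, ¬ SameCycle ρ v x) ∨ ∀ v ∈ T, ¬ SameCycle ρ v z) :
    ∀ u ∈ T, ∀ v ∈ T, SameCycle (ρ * swap x z) u v → u = v := by
  intro u hu v hv huv
  rcases (sameCycle_mul_swap_iff ρ hxz).1 huv with h | ⟨h1, h2⟩ | ⟨h1, h2⟩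
  · exact hT u hu v hv h
  · rcases hx with hx | hx
    · exact absurd h1 (hx u hu)
    · exact absurd h2 (hx v hv)
  · rcases hx with hx | hx
    · exact absurd h2 (hx v hv)
    · exact absurd h1 (hx u hu)

theorem mul_swap_fixed (h : IsPartialPerm p.val ρ S) {x : Fin n} (hx : x ∈ S) (z : Fin n)
    (hz : p.val + 1 ≤ z.val) : (ρ * swap x p) z = z := by
  have h1 : z ≠ x := fun hc => by have := h.lt x hx; rw [← hc] at this; omega
  have h2 : z ≠ p := fun hc => by rw [hc] at hz; omega
  rw [Perm.mul_apply, swap_apply_of_ne_of_ne h1 h2]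
  exact h.fixed z (by omega)

theorem doubleRise (h : IsPartialPerm p.val ρ S) {x : Fin n} (hx : x ∈ S) :
    IsPartialPerm (p.val + 1) (ρ * swap x p) (insert p (S.erase x)) := by
  have hsub : insert p (S.erase x) ⊆ insert p S := Finset.insert_subset_insert _ (S.erase_subset x)
  refine ⟨h.mul_swap_fixed hx, fun z hz => h.valley.lt z (hsub hz), sep_mul_swap
    (fun u hu v hv => h.valley.sep u (hsub hu) v (hsub hv)) (h.not_sameCycle (h.ne hx))
    (Or.inl fun v hv hc => ?_)⟩
  rcases Finset.mem_insert.1 hv with rfl | hv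
  · exact h.not_sameCycle (h.ne hx) hc.symm
  · exact Finset.ne_of_mem_erase hv (h.sep v (Finset.mem_of_mem_erase hv) x hx hc)

theorem doubleFall (h : IsPartialPerm p.val ρ S) {x : Fin n} (hx : x ∈ S) :
    IsPartialPerm (p.val + 1) (ρ * swap x p) S :=
  ⟨h.mul_swap_fixed hx, h.fixedPoint.lt, sep_mul_swap h.sep (h.not_sameCycle (h.ne hx))
    (Or.inr fun _ hv => h.not_sameCycle (h.ne hv))⟩

/-- The path that ends at `y` is appended to the path that ends at `x`. Then `x` does not end a
path any more. -/
theorem join (h : IsPartialPerm p.val ρ S) {x y : Fin n} (hx : x ∈ S) (hy : y ∈ S) :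
    IsPartialPerm p.val (ρ * swap x y) (S.erase x) := by
  refine ⟨fun z hz => ?_, fun z hz => h.lt z (Finset.mem_of_mem_erase hz), ?_⟩
  · have h1 : z ≠ x := fun hc => by have := h.lt x hx; rw [← hc] at this; omega
    have h2 : z ≠ y := fun hc => by have := h.lt y hy; rw [← hc] at this; omega
    rw [Perm.mul_apply, swap_apply_of_ne_of_ne h1 h2]
    exact h.fixed z hz
  · have hsep : ∀ u ∈ S.erase x, ∀ v ∈ S.erase x, SameCycle ρ u v → u = v := fun u hu v hv =>
      h.sep u (Finset.mem_of_mem_erase hu) v (Finset.mem_of_mem_erase hv)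
    by_cases hxy : x = y
    · subst hxy
      rwa [swap_self, ← Perm.one_def, mul_one]
    · refine sep_mul_swap hsep (fun hc => hxy (h.sep x hx y hy hc)) (Or.inl fun v hv hc => ?_)
      exact Finset.ne_of_mem_erase hv (h.sep v (Finset.mem_of_mem_erase hv) x hx hc)

theorem peak (h : IsPartialPerm p.val ρ S) {x y : Fin n} (hx : x ∈ S) (hy : y ∈ S) :
    IsPartialPerm (p.val + 1) (ρ * swap x y * swap x p) (S.erase x) := by
  have h' := h.join hx hy
  refine ⟨fun z hz => ?_, fun z hz => (h'.lt z hz).trans (Nat.lt_succ_self _), sep_mul_swap h'.sep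
    (h'.not_sameCycle (h.ne hx)) (Or.inr fun _ hv => h'.not_sameCycle (h'.ne hv))⟩
  have h1 : z ≠ x := fun hc => by have := h.lt x hx; rw [← hc] at this; omega
  have h2 : z ≠ p := fun hc => by rw [hc] at hz; omega
  rw [Perm.mul_apply, swap_apply_of_ne_of_ne h1 h2]
  exact h'.fixed z (by omega)

/-! Which extensions of a partial permutation of `{0, …, p - 1}` extend which of these. -/

theorem mem_extensions_fixedPoint (h : IsPartialPerm p.val ρ S) :
    σ ∈ extensions (p.val + 1) ρ S ↔ σ ∈ extensions p.val ρ S ∧ σ p = p := by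
  rw [mem_extensions_succ, mem_extensions, if_neg h.notMem, h.apply_self]
  refine and_congr_left fun hp => forall_congr' fun x => forall_congr' fun hx => ?_
  have : σ x ≠ p := fun hc => hx.ne (σ.injective (hc.trans hp.symm))
  split_ifs
  · exact ⟨le_of_lt, fun hle => lt_of_le_of_ne hle this.symm⟩
  · rfl

theorem mem_extensions_valley (h : IsPartialPerm p.val ρ S) :
    σ ∈ extensions (p.val + 1) ρ (insert p S) ↔
      σ ∈ extensions p.val ρ S ∧ p < σ⁻¹ p ∧ p < σ p := by
  rw [mem_extensions_succ, mem_extensions, if_pos (Finset.mem_insert_self _ _), ← and_assoc]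
  refine and_congr_left fun hp => ⟨fun H => ⟨fun x hx => ?_, ?_⟩, fun H x hx => ?_⟩
  · have := H x hx
    simp only [Finset.mem_insert, hx.ne, false_or] at this
    split_ifs with hS
    · rw [if_pos hS] at this; exact this.le
    · rwa [if_neg hS] at this
  · by_contra hc
    rcases (not_lt.1 hc).lt_or_eq with hlt | heq
    · have := H _ hlt
      simp only [Finset.mem_insert, hlt.ne, false_or, apply_inv_apply, lt_irrefl] at this
      split_ifs at this
      exact absurd this (h.apply_lt hlt).ne'
    · rw [Perm.inv_eq_iff_eq] at heq
      exact absurd heq hp.ne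
  · have := H.1 x hx
    have hne : p ≠ σ x := fun hc => by
      have := H.2; rw [hc, inv_apply_apply, ← hc] at this; exact this.not_gt hx
    simp only [Finset.mem_insert, hx.ne, false_or]
    split_ifs with hS
    · rw [if_pos hS] at this; exact lt_of_le_of_ne this hne
    · rwa [if_neg hS] at this

theorem mem_extensions_doubleRise (h : IsPartialPerm p.val ρ S) {x : Fin n} (hx : x ∈ S) :
    σ ∈ extensions (p.val + 1) (ρ * swap x p) (insert p (S.erase x)) ↔
      σ ∈ extensions p.val ρ S ∧ σ x = p ∧ p < σ p := by
  rw [mem_extensions_succ, mem_extensions, if_pos (Finset.mem_insert_self _ _), ← and_assoc]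
  have hxp : x < p := h.lt x hx
  refine and_congr_left fun hp => ⟨fun H => ?_, fun H z hz => ?_⟩
  · have hσx : σ x = p := by
      have := H x hxp
      rw [if_neg (by simp [hxp.ne]), Perm.mul_apply, swap_apply_left, h.apply_self] at this
      exact this
    refine ⟨fun z hz => ?_, hσx⟩
    by_cases hzx : z = x
    · subst hzx; rw [if_pos hx, hσx]
    · have := H z hz
      rw [Perm.mul_apply, swap_apply_of_ne_of_ne hzx hz.ne] at this
      simp only [Finset.mem_insert, hz.ne, Finset.mem_erase, hzx, false_or, ne_eq,
        not_false_eq_true, true_and] at this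
      split_ifs with hS
      · rw [if_pos hS] at this; exact this.le
      · rwa [if_neg hS] at this
  · by_cases hzx : z = x
    · subst hzx
      rw [if_neg (by simp [hxp.ne]), Perm.mul_apply, swap_apply_left, h.apply_self, H.2]
    · have := H.1 z hz
      have hne : p ≠ σ z := fun hc => hzx (σ.injective (hc.symm.trans H.2.symm))
      rw [Perm.mul_apply, swap_apply_of_ne_of_ne hzx hz.ne]
      simp only [Finset.mem_insert, hz.ne, Finset.mem_erase, hzx, false_or, ne_eq,
        not_false_eq_true, true_and]
      split_ifs with hS
      · rw [if_pos hS] at this; exact lt_of_le_of_ne this hne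
      · rwa [if_neg hS] at this

theorem mem_extensions_doubleFall (h : IsPartialPerm p.val ρ S) {x : Fin n} (hx : x ∈ S) :
    σ ∈ extensions (p.val + 1) (ρ * swap x p) S ↔
      σ ∈ extensions p.val ρ S ∧ p < σ⁻¹ p ∧ σ p = ρ x := by
  rw [mem_extensions_succ, mem_extensions, if_neg h.notMem, Perm.mul_apply, swap_apply_right,
    ← and_assoc]
  have hxp : x < p := h.lt x hx
  have hval : ∀ z, z < p → z ∉ S → (ρ * swap x p) z = ρ z := fun z hz hS => by
    rw [Perm.mul_apply, swap_apply_of_ne_of_ne (ne_of_mem_of_not_mem hx hS).symm hz.ne]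
  refine and_congr_left fun hp => ⟨fun H => ⟨fun z hz => ?_, ?_⟩, fun H z hz => ?_⟩
  · have := H z hz
    split_ifs with hS
    · rw [if_pos hS] at this; exact this.le
    · rwa [if_neg hS, hval z hz hS] at this
  · by_contra hc
    rcases (not_lt.1 hc).lt_or_eq with hlt | heq
    · have := H _ hlt
      split_ifs at this with hS
      · rw [apply_inv_apply] at this; exact lt_irrefl _ this
      · rw [hval _ hlt hS, apply_inv_apply] at this
        exact absurd this (h.apply_lt hlt).ne'
    · rw [Perm.inv_eq_iff_eq, hp] at heq
      exact absurd heq (h.apply_lt hxp).ne'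
  · have := H.1 z hz
    have hne : p ≠ σ z := fun hc => by
      have := H.2; rw [hc, inv_apply_apply, ← hc] at this; exact this.not_gt hz
    split_ifs with hS
    · rw [if_pos hS] at this; exact lt_of_le_of_ne this hne
    · rwa [if_neg hS, ← hval z hz hS] at this

theorem mem_extensions_peak (h : IsPartialPerm p.val ρ S) {x y : Fin n} (hx : x ∈ S)
    (hy : y ∈ S) :
    σ ∈ extensions (p.val + 1) (ρ * swap x y * swap x p) (S.erase x) ↔
      σ ∈ extensions p.val ρ S ∧ σ x = p ∧ σ p = ρ y := by
  have hxp : x < p := h.lt x hx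
  rw [mem_extensions_succ, mem_extensions, if_neg fun hp => h.notMem (Finset.mem_of_mem_erase hp),
    Perm.mul_apply _ _ p, swap_apply_right, Perm.mul_apply, swap_apply_left, ← and_assoc]
  have hval : ∀ z, z < p → z ∉ S → (ρ * swap x y * swap x p) z = ρ z := fun z hz hS => by
    have hzx : z ≠ x := fun hc => hS (hc ▸ hx)
    rw [Perm.mul_apply, Perm.mul_apply, swap_apply_of_ne_of_ne hzx hz.ne,
      swap_apply_of_ne_of_ne hzx (fun hc => hS (hc ▸ hy))]
  have hvalx : (ρ * swap x y * swap x p) x = p := by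
    rw [Perm.mul_apply, swap_apply_left, Perm.mul_apply,
      swap_apply_of_ne_of_ne hxp.ne' (h.ne hy).symm, h.apply_self]
  refine and_congr_left fun hp => ⟨fun H => ?_, fun H z hz => ?_⟩
  · have hσx : σ x = p := by
      have := H x hxp
      rwa [if_neg (Finset.notMem_erase _ _), hvalx] at this
    refine ⟨fun z hz => ?_, hσx⟩
    by_cases hzx : z = x
    · subst hzx; rw [if_pos hx, hσx]
    · have := H z hz
      simp only [Finset.mem_erase, hzx, ne_eq, not_false_eq_true, true_and] at this
      split_ifs with hS
      · rw [if_pos hS] at this; exact this.le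
      · rwa [if_neg hS, hval z hz hS] at this
  · by_cases hzx : z = x
    · subst hzx
      rw [if_neg (Finset.notMem_erase _ _), hvalx, H.2]
    · have := H.1 z hz
      have hne : p ≠ σ z := fun hc => hzx (σ.injective (hc.symm.trans H.2.symm))
      simp only [Finset.mem_erase, hzx, ne_eq, not_false_eq_true, true_and]
      split_ifs with hS
      · rw [if_pos hS] at this; exact lt_of_le_of_ne this hne
      · rwa [if_neg hS, ← hval z hz hS] at this

/-! The statistics at `p` of an extension. -/

theorem mem_iff_le_apply (h : IsPartialPerm p.val ρ S) (hσ : σ ∈ extensions p.val ρ S)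
    {x : Fin n} (hx : x < p) : x ∈ S ↔ p ≤ σ x := by
  have := mem_extensions.1 hσ x hx
  split_ifs at this with hS
  · exact ⟨fun _ => this, fun _ => hS⟩
  · exact ⟨fun hc => absurd hc hS, fun hc => absurd (this ▸ h.apply_lt hx) hc.not_gt⟩

/-- The values `v < p` that are not taken before `p` are the first elements of the open paths. -/
theorem mem_image_iff (h : IsPartialPerm p.val ρ S) (hσ : σ ∈ extensions p.val ρ S)
    {v : Fin n} (hv : v < p) : v ∈ S.image ρ ↔ p ≤ σ⁻¹ v := by
  rw [Finset.mem_image]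
  constructor
  · rintro ⟨x, hx, rfl⟩
    by_contra hc
    have hlt := not_le.1 hc
    have := mem_extensions.1 hσ _ hlt
    rw [apply_inv_apply] at this
    split_ifs at this with hS
    · exact hv.not_ge this
    · exact hS (ρ.injective this ▸ hx)
  · intro hle
    -- `v` is taken by `ρ` at some place before `p`, where `σ` cannot agree with `ρ`.
    have hlt : ρ⁻¹ v < p := by
      by_contra hc
      have := h.fixed _ (not_lt.1 hc)
      rw [apply_inv_apply] at this
      exact hc (this ▸ hv)
    refine ⟨ρ⁻¹ v, ?_, apply_inv_apply _ _⟩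
    by_contra hS
    have := mem_extensions.1 hσ _ hlt
    rw [if_neg hS, apply_inv_apply, ← Perm.eq_inv_iff_eq] at this
    exact hlt.not_ge (this ▸ hle)

theorem lev_eq (h : IsPartialPerm p.val ρ S) (hσ : σ ∈ extensions p.val ρ S) :
    lev σ p = (S.filter fun x => σ x ≠ p).card := by
  unfold lev
  congr 1
  ext x
  simp only [Finset.mem_filter, Finset.mem_univ, true_and]
  constructor
  · rintro ⟨h1, h2⟩
    exact ⟨(h.mem_iff_le_apply hσ h1).2 h2.le, h2.ne'⟩
  · rintro ⟨h1, h2⟩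
    exact ⟨h.lt x h1, lt_of_le_of_ne ((h.mem_iff_le_apply hσ (h.lt x h1)).1 h1) h2.symm⟩

theorem lev_eq_card (h : IsPartialPerm p.val ρ S) (hσ : σ ∈ extensions p.val ρ S)
    (hp : p ≤ σ⁻¹ p) : lev σ p = S.card := by
  rw [h.lev_eq hσ, Finset.filter_true_of_mem]
  rintro x hx hc
  rw [← hc, inv_apply_apply, hc] at hp
  exact (h.lt x hx).not_ge hp

theorem lev_eq_card_sub_one (h : IsPartialPerm p.val ρ S) (hσ : σ ∈ extensions p.val ρ S)
    {x : Fin n} (hx : x ∈ S) (hp : σ x = p) : lev σ p = S.card - 1 := by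
  rw [h.lev_eq hσ, ← Finset.card_erase_of_mem hx]
  congr 1
  ext z
  rw [Finset.mem_filter, Finset.mem_erase, and_comm, ← hp, σ.injective.ne_iff]

theorem unest_eq (h : IsPartialPerm p.val ρ S) (hσ : σ ∈ extensions p.val ρ S)
    {x : Fin n} (hx : x ∈ S) (hp : σ x = p) : unest σ x = (S.filter (· < x)).card := by
  have hxp : x < p := h.lt x hx
  unfold unest
  congr 1
  ext z
  simp only [Finset.mem_filter, Finset.mem_univ, true_and, hp]
  constructor
  · rintro ⟨h1, -, h3⟩
    exact ⟨(h.mem_iff_le_apply hσ (h1.trans hxp)).2 h3.le, h1⟩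
  · rintro ⟨h1, h2⟩
    refine ⟨h2, hxp, lt_of_le_of_ne ((h.mem_iff_le_apply hσ (h.lt z h1)).1 h1) fun hc => ?_⟩
    exact h2.ne (σ.injective (hc.symm.trans hp.symm))

theorem lcross_eq (h : IsPartialPerm p.val ρ S) (hσ : σ ∈ extensions p.val ρ S) :
    lcross σ p = ((S.image ρ).filter (σ p < ·)).card := by
  unfold lcross
  rw [← Finset.card_image_of_injective _ σ.injective]
  congr 1
  ext v
  simp only [Finset.mem_image, Finset.mem_filter, Finset.mem_univ, true_and]
  rw [← Finset.mem_image]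
  constructor
  · rintro ⟨l, ⟨h1, h2, h3⟩, rfl⟩
    exact ⟨(h.mem_image_iff hσ h2).2 (by rw [inv_apply_apply]; exact h3.le), h1⟩
  · rintro ⟨h1, h2⟩
    have hv : v < p := by
      obtain ⟨x, hx, rfl⟩ := Finset.mem_image.1 h1
      exact h.apply_lt (h.lt x hx)
    have hle := (h.mem_image_iff hσ hv).1 h1
    refine ⟨σ⁻¹ v, ⟨by rwa [apply_inv_apply], by rwa [apply_inv_apply],
      lt_of_le_of_ne hle fun hc => ?_⟩, apply_inv_apply _ _⟩
    rw [hc, apply_inv_apply] at h2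
    exact lt_irrefl _ h2

theorem lnest_eq (h : IsPartialPerm p.val ρ S) (hσ : σ ∈ extensions p.val ρ S) (hp : σ p < p) :
    lnest σ p = ((S.image ρ).filter (· < σ p)).card := by
  unfold lnest
  rw [← Finset.card_image_of_injective _ σ.injective]
  congr 1
  ext v
  simp only [Finset.mem_image, Finset.mem_filter, Finset.mem_univ, true_and]
  rw [← Finset.mem_image]
  constructor
  · rintro ⟨l, ⟨h1, -, h3⟩, rfl⟩
    exact ⟨(h.mem_image_iff hσ (h1.trans hp)).2 (by rw [inv_apply_apply]; exact h3.le), h1⟩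
  · rintro ⟨h1, h2⟩
    have hle := (h.mem_image_iff hσ (h2.trans hp)).1 h1
    refine ⟨σ⁻¹ v, ⟨by rwa [apply_inv_apply], hp, lt_of_le_of_ne hle fun hc => ?_⟩,
      apply_inv_apply _ _⟩
    rw [hc, apply_inv_apply] at h2
    exact lt_irrefl _ h2

end IsPartialPerm

/-- The quadruplets counted by `ucross` and `unest` together forget the value at `j`. -/
theorem ucross_add_unest (σ : Perm (Fin n)) {j : Fin n} (hj : j < σ j) :
    ucross σ j + unest σ j = lev σ j := by
  unfold ucross unest lev
  rw [← Finset.card_union_of_disjoint]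
  · congr 1
    ext i
    simp only [Finset.mem_union, Finset.mem_filter, Finset.mem_univ, true_and]
    constructor
    · rintro (⟨h1, h2, -⟩ | ⟨h1, -, h3⟩)
      · exact ⟨h1, h2⟩
      · exact ⟨h1, hj.trans h3⟩
    · rintro ⟨h1, h2⟩
      rcases lt_trichotomy (σ i) (σ j) with h | h | h
      · exact Or.inl ⟨h1, h2, h⟩
      · exact absurd (σ.injective h) h1.ne
      · exact Or.inr ⟨h1, hj, h⟩
  · rw [Finset.disjoint_filter]
    rintro i - ⟨-, -, h⟩ ⟨-, -, h'⟩
    exact lt_asymm h h'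

end Extensions

/-! ### Summation over the extensions of a partial permutation -/

section Summation

open Equiv Equiv.Perm

variable {n : ℕ} {R : Type*}

namespace IsPartialPerm

variable {p : Fin n} {ρ σ : Perm (Fin n)} {S : Finset (Fin n)}

theorem exists_apply_eq (h : IsPartialPerm p.val ρ S) (hσ : σ ∈ extensions p.val ρ S)
    (hp : σ p < p) : ∃ y ∈ S, σ p = ρ y := by
  have := (h.mem_image_iff hσ hp).2 (by rw [inv_apply_apply])
  obtain ⟨y, hy, hy'⟩ := Finset.mem_image.1 this
  exact ⟨y, hy, hy'.symm⟩

/-- The extensions are sorted by what happens at `p`. -/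
theorem sum_extensions [AddCommMonoid R] (h : IsPartialPerm p.val ρ S) (f : Perm (Fin n) → R) :
    ∑ σ ∈ extensions p.val ρ S, f σ =
      ∑ σ ∈ extensions (p.val + 1) ρ S, f σ
      + ∑ σ ∈ extensions (p.val + 1) ρ (insert p S), f σ
      + ∑ x ∈ S, ∑ σ ∈ extensions (p.val + 1) (ρ * swap x p) (insert p (S.erase x)), f σ
      + ∑ y ∈ S, ∑ σ ∈ extensions (p.val + 1) (ρ * swap y p) S, f σ
      + ∑ y ∈ S, ∑ x ∈ S,
          ∑ σ ∈ extensions (p.val + 1) (ρ * swap x y * swap x p) (S.erase x), f σ := by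
  have split : ∀ (T : Finset (Perm (Fin n))) (P : Perm (Fin n) → Prop) [DecidablePred P],
      (∀ σ, σ ∈ T ↔ σ ∈ extensions p.val ρ S ∧ P σ) →
      ∑ σ ∈ T, f σ = ∑ σ ∈ extensions p.val ρ S, if P σ then f σ else 0 := by
    intro T P _ hT
    rw [← Finset.sum_filter]
    congr 1
    ext σ
    rw [hT, Finset.mem_filter]
  rw [split _ _ fun σ => h.mem_extensions_fixedPoint,
    split _ _ fun σ => h.mem_extensions_valley,
    Finset.sum_congr rfl fun x hx => split _ _ fun σ => h.mem_extensions_doubleRise hx,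
    Finset.sum_congr rfl fun y hy => split _ _ fun σ => h.mem_extensions_doubleFall hy,
    Finset.sum_congr rfl fun y hy => Finset.sum_congr rfl fun x hx =>
      split _ _ fun σ => h.mem_extensions_peak hx hy,
    Finset.sum_congr rfl fun y _ => Finset.sum_comm, Finset.sum_comm (s := S),
    Finset.sum_comm (s := S), Finset.sum_comm (s := S), ← Finset.sum_add_distrib,
    ← Finset.sum_add_distrib, ← Finset.sum_add_distrib, ← Finset.sum_add_distrib]
  refine Finset.sum_congr rfl fun σ hσ => ?_
  have hinv : ∀ x, σ x = p ↔ σ⁻¹ p = x := fun x => by rw [Perm.inv_eq_iff_eq, eq_comm]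
  have hmem : σ⁻¹ p < p → σ⁻¹ p ∈ S := fun hlt =>
    (h.mem_iff_le_apply hσ hlt).2 (by rw [apply_inv_apply])
  have hnot : p ≤ σ⁻¹ p → ∀ x ∈ S, σ x ≠ p := fun hle x hx hc =>
    (h.lt x hx).not_ge ((hinv x).1 hc ▸ hle)
  have hnot' : p ≤ σ p → ∀ y ∈ S, σ p ≠ ρ y := fun hle y hy hc =>
    (h.apply_lt (h.lt y hy)).not_ge (hc ▸ hle)
  rcases lt_trichotomy (σ p) p with hp | hp | hp
  · obtain ⟨y, hy, hpy⟩ := h.exists_apply_eq hσ hp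
    have hy' : ∀ z, σ p = ρ z ↔ y = z := fun z => by rw [hpy, ρ.injective.eq_iff]
    rw [if_neg hp.ne, if_neg fun hc => hp.not_gt hc.2,
      Finset.sum_eq_zero fun x _ => if_neg fun hc => hp.not_gt hc.2]
    rcases lt_or_ge p (σ⁻¹ p) with hq | hq
    · have h2 : ∑ z ∈ S, ∑ x ∈ S, (if σ x = p ∧ σ p = ρ z then f σ else 0) = 0 :=
        Finset.sum_eq_zero fun z _ => Finset.sum_eq_zero fun x hx =>
          if_neg fun hc => hnot hq.le x hx hc.1
      rw [h2]
      simp only [hq, hy', true_and, Finset.sum_ite_eq, if_pos hy, zero_add, add_zero]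
    · have hq' : σ⁻¹ p < p := lt_of_le_of_ne hq fun hc => hp.ne ((hinv p).2 hc)
      rw [Finset.sum_eq_zero fun y _ => if_neg fun hc => hq.not_gt hc.1]
      simp only [hinv, hy', ite_and, Finset.sum_ite_eq, if_pos hy, if_pos (hmem hq'), zero_add]
  · have hq : σ⁻¹ p = p := (hinv p).1 hp
    rw [if_pos hp, if_neg fun hc => hc.2.ne' hp,
      Finset.sum_eq_zero fun x _ => if_neg fun hc => hc.2.ne' hp,
      Finset.sum_eq_zero fun y _ => if_neg fun hc => hc.1.ne' hq,
      Finset.sum_eq_zero fun y hy => Finset.sum_eq_zero fun x _ =>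
        if_neg fun hc => hnot' hp.ge y hy hc.2]
    simp only [add_zero]
  · rw [if_neg hp.ne', Finset.sum_eq_zero (s := S) (f := fun y =>
        if p < σ⁻¹ p ∧ σ p = ρ y then f σ else 0) fun y hy => if_neg fun hc => hnot' hp.le y hy hc.2,
      Finset.sum_eq_zero (s := S) (f := fun y =>
        ∑ x ∈ S, if σ x = p ∧ σ p = ρ y then f σ else 0) fun y hy => Finset.sum_eq_zero fun x _ =>
        if_neg fun hc => hnot' hp.le y hy hc.2]
    rcases lt_or_ge p (σ⁻¹ p) with hq | hq
    · rw [if_pos ⟨hq, hp⟩, Finset.sum_eq_zero fun x hx => if_neg fun hc => hnot hq.le x hx hc.1]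
      simp only [zero_add, add_zero]
    · have hq' : σ⁻¹ p < p := lt_of_le_of_ne hq fun hc => hp.ne' ((hinv p).2 hc)
      rw [if_neg fun hc => hq.not_gt hc.1]
      simp only [hinv, hp, and_true, Finset.sum_ite_eq, if_pos (hmem hq'), zero_add, add_zero]

variable (a : ℕ → R) (b c d : ℕ → ℕ → R) (e : ℕ → R)

theorem localWeight_fixedPoint (h : IsPartialPerm p.val ρ S)
    (hσ : σ ∈ extensions (p.val + 1) ρ S) : localWeight a b c d e σ p = e S.card := by
  obtain ⟨hσ, hp⟩ := h.mem_extensions_fixedPoint.1 hσ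
  rw [localWeight, if_pos hp, h.lev_eq_card hσ (Perm.inv_eq_iff_eq.2 hp.symm).ge]

theorem localWeight_valley (h : IsPartialPerm p.val ρ S)
    (hσ : σ ∈ extensions (p.val + 1) ρ (insert p S)) :
    localWeight a b c d e σ p = a S.card := by
  obtain ⟨hσ, hq, hp⟩ := h.mem_extensions_valley.1 hσ
  rw [localWeight, if_neg hp.ne', if_pos hq, if_pos hp, ucross_add_unest σ hp,
    h.lev_eq_card hσ hq.le]

theorem localWeight_doubleRise (h : IsPartialPerm p.val ρ S) {x : Fin n} (hx : x ∈ S)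
    (hσ : σ ∈ extensions (p.val + 1) (ρ * swap x p) (insert p (S.erase x))) :
    localWeight a b c d e σ p = d (S.card - 1) (S.filter (· < x)).card := by
  obtain ⟨hσ, hq, hp⟩ := (h.mem_extensions_doubleRise hx).1 hσ
  have hq' : σ⁻¹ p = x := Perm.inv_eq_iff_eq.2 hq.symm
  have hxp : x < p := h.lt x hx
  rw [localWeight, if_neg hp.ne', hq', if_neg hxp.not_gt, if_pos hp, ucross_add_unest σ hp,
    h.lev_eq_card_sub_one hσ hx hq, h.unest_eq hσ hx hq]

theorem localWeight_doubleFall (h : IsPartialPerm p.val ρ S) {y : Fin n} (hy : y ∈ S)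
    (hσ : σ ∈ extensions (p.val + 1) (ρ * swap y p) S) :
    localWeight a b c d e σ p =
      c ((S.image ρ).filter (ρ y < ·)).card ((S.image ρ).filter (· < ρ y)).card := by
  obtain ⟨hσ, hq, hp⟩ := (h.mem_extensions_doubleFall hy).1 hσ
  have hlt : σ p < p := hp ▸ h.apply_lt (h.lt y hy)
  rw [localWeight, if_neg hlt.ne, if_pos hq, if_neg hlt.not_gt, h.lcross_eq hσ,
    h.lnest_eq hσ hlt, hp]

theorem localWeight_peak (h : IsPartialPerm p.val ρ S) {x y : Fin n} (hx : x ∈ S) (hy : y ∈ S)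
    (hσ : σ ∈ extensions (p.val + 1) (ρ * swap x y * swap x p) (S.erase x)) :
    localWeight a b c d e σ p =
      b ((S.image ρ).filter (ρ y < ·)).card ((S.image ρ).filter (· < ρ y)).card := by
  obtain ⟨hσ, hq, hp⟩ := (h.mem_extensions_peak hx hy).1 hσ
  have hq' : σ⁻¹ p = x := Perm.inv_eq_iff_eq.2 hq.symm
  have hxp : x < p := h.lt x hx
  have hlt : σ p < p := hp ▸ h.apply_lt (h.lt y hy)
  rw [localWeight, if_neg hlt.ne, hq', if_neg hxp.not_gt, if_neg hlt.not_gt, h.lcross_eq hσ,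
    h.lnest_eq hσ hlt, hp]

theorem sum_image_eq_starPred [CommRing R] (S : Finset (Fin n)) (ρ : Perm (Fin n)) (x : ℕ → ℕ → R) :
    ∑ y ∈ S, x ((S.image ρ).filter (ρ y < ·)).card ((S.image ρ).filter (· < ρ y)).card =
      starPred x S.card := by
  rw [← Finset.card_image_of_injective S ρ.injective, ← sum_card_filter_gt_lt,
    Finset.sum_image ρ.injective.injOn]

end IsPartialPerm

variable [CommRing R]

theorem motzkin_succ (α γ δ : ℕ → R) (hδ : δ 0 = 0) (m k : ℕ) :
    motzkin α γ δ (m + 1) k = γ k * motzkin α γ δ m k + α k * motzkin α γ δ m (k + 1)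
      + δ k * motzkin α γ δ m (k - 1) := by
  cases k with
  | zero => simp [motzkin, hδ]
  | succ k => simp [motzkin]

theorem extensions_self {ρ : Perm (Fin n)} {S : Finset (Fin n)} :
    extensions n ρ S = if S = ∅ then {ρ} else ∅ := by
  split_ifs with hS
  · subst hS
    ext σ
    simp [extensions, Perm.ext_iff]
  · obtain ⟨x, hx⟩ := Finset.nonempty_iff_ne_empty.2 hS
    rw [Finset.eq_empty_iff_forall_notMem]
    intro σ hσ
    have := (Finset.mem_filter.1 hσ).2 x x.isLt
    rw [if_pos hx] at this
    exact absurd (σ x).isLt this.not_gt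

theorem prod_filter_le_eq_mul (p : Fin n) (w : Fin n → R) :
    ∏ i with p.val ≤ i.val, w i = w p * ∏ i with p.val + 1 ≤ i.val, w i := by
  have : (Finset.univ.filter fun i : Fin n => p.val ≤ i.val) =
      insert p (Finset.univ.filter fun i : Fin n => p.val + 1 ≤ i.val) := by
    ext i
    simp only [Finset.mem_filter, Finset.mem_univ, true_and, Finset.mem_insert, Fin.ext_iff]
    omega
  rw [this, Finset.prod_insert (by simp)]

/-- The heart of the proof: what a partial permutation of `{0, …, j - 1}` contributes to the total
weight from `j` on depends on its number of open paths only, and is a Motzkin polynomial. A cycle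
peak at `j` is put between the end of one of the `k` open paths and the start of another or the
same one; for each choice of the start, exactly one of the `k` ends closes a cycle, whence the
factor `λ + k - 1`. The number of cycles that are already closed is `r`: the other cycles of `ρ`
are the `m` fixed points from `j` on and the closures of the open paths. -/
theorem sum_extensions_eq_motzkin (a : ℕ → R) (b c d : ℕ → ℕ → R) (e : ℕ → R) (lam : R)
    (m j : ℕ) (hj : j + m = n) (ρ : Perm (Fin n)) (S : Finset (Fin n))
    (h : IsPartialPerm j ρ S) (r : ℕ) (hr : cyc ρ = r + m + S.card) :
    ∑ σ ∈ extensions j ρ S,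
        lam ^ cyc σ * ∏ i with j ≤ i.val, localWeight a b c d e σ i =
      lam ^ r * motzkin a (fun k => starPred c k + naturalPred d k + lam * e k)
        (fun k => (lam + (k : R) - 1) * starPred b k) m S.card := by
  induction m generalizing j ρ S r with
  | zero =>
    obtain rfl : j = n := hj
    rw [extensions_self, motzkin]
    by_cases hS : S = ∅
    · subst hS
      simp only [Finset.card_empty, add_zero] at hr
      have hempty : (Finset.univ.filter fun i : Fin j => j ≤ i.val) = ∅ :=
        Finset.filter_false_of_mem fun i _ => i.isLt.not_ge
      simp [hr, hempty]
    · simp [hS]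
  | succ m ih =>
    set F := motzkin a (fun k => starPred c k + naturalPred d k + lam * e k)
        (fun k => (lam + (k : R) - 1) * starPred b k) with hF
    obtain ⟨p, rfl⟩ : ∃ p : Fin n, p.val = j := ⟨⟨j, by omega⟩, rfl⟩
    -- On each of the smaller classes the weight of `p` is constant.
    have step : ∀ (ρ' : Perm (Fin n)) (S' : Finset (Fin n)) (r' : ℕ) (w : R),
        IsPartialPerm (p.val + 1) ρ' S' → cyc ρ' = r' + m + S'.card →
        (∀ σ ∈ extensions (p.val + 1) ρ' S', localWeight a b c d e σ p = w) →
        ∑ σ ∈ extensions (p.val + 1) ρ' S',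
          lam ^ cyc σ * ∏ i with p.val ≤ i.val, localWeight a b c d e σ i =
        w * (lam ^ r' * F m S'.card) := by
      intro ρ' S' r' w h' hr' hw
      rw [← ih (p.val + 1) (by omega) ρ' S' h' r' hr', Finset.mul_sum]
      refine Finset.sum_congr rfl fun σ hσ => ?_
      rw [prod_filter_le_eq_mul, hw σ hσ]
      ring
    have hfix := step ρ S (r + 1) _ h.fixedPoint (by omega)
      fun σ hσ => h.localWeight_fixedPoint a b c d e hσ
    have hval := step ρ (insert p S) r _ h.valley
      (by rw [Finset.card_insert_of_notMem h.notMem]; omega)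
      fun σ hσ => h.localWeight_valley a b c d e hσ
    rw [Finset.card_insert_of_notMem h.notMem] at hval
    have hrise : ∀ x ∈ S, ∑ σ ∈ extensions (p.val + 1) (ρ * swap x p) (insert p (S.erase x)),
        lam ^ cyc σ * ∏ i with p.val ≤ i.val, localWeight a b c d e σ i =
        d (S.card - 1) (S.filter (· < x)).card * (lam ^ r * F m S.card) := by
      intro x hx
      have hcard : (insert p (S.erase x)).card = S.card := by
        rw [Finset.card_insert_of_notMem fun hp => h.notMem (Finset.mem_of_mem_erase hp),
          Finset.card_erase_add_one hx]
      have := step _ _ r _ (h.doubleRise hx)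
        (by have := cyc_mul_swap ρ (h.not_sameCycle (h.ne hx)); omega)
        fun σ hσ => h.localWeight_doubleRise a b c d e hx hσ
      rwa [hcard] at this
    have hfall : ∀ y ∈ S, ∑ σ ∈ extensions (p.val + 1) (ρ * swap y p) S,
        lam ^ cyc σ * ∏ i with p.val ≤ i.val, localWeight a b c d e σ i =
        c ((S.image ρ).filter (ρ y < ·)).card ((S.image ρ).filter (· < ρ y)).card
          * (lam ^ r * F m S.card) := fun y hy =>
      step _ _ r _ (h.doubleFall hy)
        (by have := cyc_mul_swap ρ (h.not_sameCycle (h.ne hy)); omega)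
        fun σ hσ => h.localWeight_doubleFall a b c d e hy hσ
    have hpeak : ∀ y ∈ S, ∀ x ∈ S,
        ∑ σ ∈ extensions (p.val + 1) (ρ * swap x y * swap x p) (S.erase x),
          lam ^ cyc σ * ∏ i with p.val ≤ i.val, localWeight a b c d e σ i =
        (if x = y then lam else 1) *
          (b ((S.image ρ).filter (ρ y < ·)).card ((S.image ρ).filter (· < ρ y)).card
            * (lam ^ r * F m (S.card - 1))) := by
      intro y hy x hx
      have h' := h.join hx hy
      have hc := cyc_mul_swap (ρ * swap x y) (h'.not_sameCycle (h.ne hx))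
      have hcard := Finset.card_erase_add_one hx
      by_cases hxy : x = y
      · subst hxy
        have hc' : cyc (ρ * swap x x) = cyc ρ := by rw [swap_self, ← Perm.one_def, mul_one]
        rw [step _ _ (r + 1) _ (h.peak hx hy) (by omega)
          fun σ hσ => h.localWeight_peak a b c d e hx hy hσ, if_pos rfl,
          Finset.card_erase_of_mem hx]
        ring
      · have hc' := cyc_mul_swap ρ (fun hc => hxy (h.sep x hx y hy hc))
        rw [step _ _ r _ (h.peak hx hy) (by omega)
          fun σ hσ => h.localWeight_peak a b c d e hx hy hσ, if_neg hxy,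
          Finset.card_erase_of_mem hx, one_mul]
    have hlam : ∀ y ∈ S, ∑ x ∈ S, (if x = y then lam else 1) = lam + (S.card : R) - 1 := by
      intro y hy
      rw [← Finset.add_sum_erase S _ hy, if_pos rfl, Finset.sum_congr rfl fun x hx =>
        if_neg (Finset.ne_of_mem_erase hx), Finset.sum_const, nsmul_one,
        Finset.cast_card_erase_of_mem hy]
      ring
    rw [h.sum_extensions, hfix, hval, Finset.sum_congr rfl hrise, Finset.sum_congr rfl hfall,
      Finset.sum_congr rfl fun y hy => (Finset.sum_congr rfl (hpeak y hy)).trans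
        ((Finset.sum_mul _ _ _).symm.trans (congrArg (· * _) (hlam y hy))),
      ← Finset.mul_sum, ← Finset.sum_mul, ← Finset.sum_mul, ← Finset.sum_mul,
      sum_card_filter_lt S (d (S.card - 1)), IsPartialPerm.sum_image_eq_starPred,
      IsPartialPerm.sum_image_eq_starPred, hF, motzkin_succ _ _ _ (by simp [starPred]),
      naturalPred]
    ring

theorem Qhat_eq_motzkin (a : ℕ → R) (b c d : ℕ → ℕ → R) (e : ℕ → R) (lam : R) (n : ℕ) :
    Qhat a b c d e lam n =
      motzkin a (fun k => starPred c k + naturalPred d k + lam * e k)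
        (fun k => (lam + (k : R) - 1) * starPred b k) n 0 := by
  have h : IsPartialPerm 0 (1 : Perm (Fin n)) ∅ := ⟨fun _ _ => rfl, by simp, by simp⟩
  have hext : extensions 0 (1 : Perm (Fin n)) ∅ = Finset.univ := by simp [extensions]
  have := sum_extensions_eq_motzkin a b c d e lam n 0 (zero_add n) 1 ∅ h 0 (by simp [cyc_one])
  rw [hext, pow_zero, one_mul, Finset.card_empty] at this
  rw [Qhat_eq_sum_prod_localWeight, ← this]
  simp

end Summation

end PermJ

theorem theorem2p14 {R : Type*} [CommRing R]
    (a : ℕ → R) (b c d : ℕ → ℕ → R) (e : ℕ → R) (lam : R) :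
    PermJ.HasJFraction
      (PowerSeries.mk (PermJ.Qhat a b c d e lam))
      (fun n => PermJ.starPred c n + PermJ.naturalPred d n + lam * e n)
      (fun n => (lam + (n : R) - 1) * a (n - 1) * PermJ.starPred b n) := by
  rw [funext (PermJ.Qhat_eq_motzkin a b c d e lam)]
  refine PermJ.hasJFraction_motzkin _ _ _ _ fun k => ?_
  rw [Nat.add_sub_cancel]
  ring
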